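/- For every natural number $k \equiv 3 \pmod 5$, the number $$n=\frac{512k^5+1280k^4+6560k^3+7600k^2+4180k+1344}{3125}$$ is a positive integer, and there is an undirected circulant graph (a Cayley graph of the cyclic group $\mathbb{Z}_n$) of order $n$, regular of degree $10$, with diameter exactly $k$. Moreover, a generating set for this graph is $\{g_1,\dots,g_5\}$ with the integers $$g_1=1,\qquad g_2=\frac{128k^4+64k^3+1112k^2-1224k-1557}{625},\qquad g_3=\frac{256k^4+448k^3+2944k^2+1592k+271}{625},$$ $$g_4=\frac{256k^4+608k^3+3104k^2+3062k+726}{625},\qquad g_5=\frac{384k^4+672k^3+4216k^2+2338k-456}{625}.$$ That is, the residues of $g_1,\dots,g_5$ modulo $n$ are five distinct elements that generate $\mathbb{Z}_n$, no one of them is the negative of itself or of another, and two vertices $u,v\in\mathbb{Z}_n$ are adjacent if and only if $v-u\in\{\pm g_1,\dots,\pm g_5\}$. -/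

import Mathlib

/-- The connection set of the circulant graph on `ZMod n` determined by a set `S` of generators:
all elements of `S` together with their additive inverses. -/
def connectionSet {n : ℕ} (S : Set (ZMod n)) : Set (ZMod n) :=
  {c | c ∈ S ∨ -c ∈ S}

/-- The undirected circulant graph `X(ZMod n, connectionSet S)`: distinct vertices `u`, `v` are
adjacent if and only if `v - u` (equivalently `u - v`) lies in the connection set. -/
def circulantGraphOf {n : ℕ} (S : Set (ZMod n)) : SimpleGraph (ZMod n) :=
  SimpleGraph.circulantGraph (connectionSet S)

/-! Put `k = 5m + 3`. The diameter is the `ℓ¹` covering radius of the lattice `L` of integer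
relations among the generators modulo `n`. In the coordinates `(p, r, s, t, u) = (x₀, -x₂, x₁, x₃,
-x₄)`, `L` contains with index two the span of vectors `b_p, b_r, b_s, b_t, b_u` whose matrix is
diagonal (entries `4m+3`, once `4m+2`) plus a skew-symmetric matrix with entries `0, ±1`; half their
sum is the missing generator. By skew-symmetry each `½ ∑ εᵢ bᵢ` has `ℓ¹`-norm half the trace, `10m +
7`, and lies in the closed orthant of `ε`.

Upper bound: if a shortest vector `x` of its class lies in the box between `0` and such a `v`, then
`2|x| ≤ |x| + |x - v| = 10m + 7`, so `|x| ≤ 5m + 3` (`IsShortest.norm_le_of_signs`). Comparing `x`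
with translates by short combinations of the `bᵢ` forces it into such a box
(`false_of_bounds_of_forall_orthant`).

Lower bound: vectors with all coordinates at most `2m` in absolute value are shortest modulo the
sublattice (`norm_le_norm_sub`). Applied to both cosets of the sublattice in `L`, this yields a
class of minimal norm `5m + 3` (`le_norm_deepHole_sub`).

These estimates need `m ≥ 1`; the case `m = 0`, `n = 156`, is a finite computation. -/

/-! ### Upper bound for the norm of shortest vectors -/

/-- Vectors `(p, r, s, t, u)` of minimal `ℓ¹`-norm modulo the lattice that is spanned by
`(4m+3, 0, 1, 1, 1)`, `(0, 4m+3, 1, 1, 1)`, `(-1, -1, 4m+2, 0, 0)`, `(-1, -1, 0, 4m+3, 1)`,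
`(-1, -1, 0, -1, 4m+3)` and half the sum of these five vectors. -/
def IsShortest (m p r s t u : ℤ) : Prop :=
  ∀ cp cr cs ct cu w : ℤ, |p| + |r| + |s| + |t| + |u| ≤
    |p - ((4 * m + 3) * cp - cs - ct - cu + 2 * m * w)| +
    |r - ((4 * m + 3) * cr - cs - ct - cu + 2 * m * w)| +
    |s - (cp + cr + (4 * m + 2) * cs + (2 * m + 2) * w)| +
    |t - (cp + cr + (4 * m + 3) * ct - cu + (2 * m + 2) * w)| +
    |u - (cp + cr + ct + (4 * m + 3) * cu + (2 * m + 3) * w)|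

set_option maxHeartbeats 4000000 in
/-- The bounds on a shortest vector `(p, r, s, t, u)` that come from lattice vectors with at most
three large coordinates put it into the box spanned by `0` and a lattice vector `½ ∑ ± bᵢ` of a
suitable orthant. Here `αz` and `βz` stand for `|z - 1| - |z|` and `|z + 1| - |z|`, and `yz`
for `|z|`; the last hypothesis says that the vector leaves the box in every orthant. -/
theorem false_of_bounds_of_forall_orthant (m p r s t u αp βp αr βr αs βs αt βt αu βu yp yr ys yt
  yu : ℤ)
    (hp : (0 < p ∧ αp = -1 ∧ βp = 1 ∧ yp = p) ∨
      (p < 0 ∧ αp = 1 ∧ βp = -1 ∧ yp = -p) ∨ (p = 0 ∧ αp = 1 ∧ βp = 1 ∧ yp = 0))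
    (hr : (0 < r ∧ αr = -1 ∧ βr = 1 ∧ yr = r) ∨
      (r < 0 ∧ αr = 1 ∧ βr = -1 ∧ yr = -r) ∨ (r = 0 ∧ αr = 1 ∧ βr = 1 ∧ yr = 0))
    (hs : (0 < s ∧ αs = -1 ∧ βs = 1 ∧ ys = s) ∨
      (s < 0 ∧ αs = 1 ∧ βs = -1 ∧ ys = -s) ∨ (s = 0 ∧ αs = 1 ∧ βs = 1 ∧ ys = 0))
    (ht : (0 < t ∧ αt = -1 ∧ βt = 1 ∧ yt = t) ∨
      (t < 0 ∧ αt = 1 ∧ βt = -1 ∧ yt = -t) ∨ (t = 0 ∧ αt = 1 ∧ βt = 1 ∧ yt = 0))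
    (hu : (0 < u ∧ αu = -1 ∧ βu = 1 ∧ yu = u) ∨
      (u < 0 ∧ αu = 1 ∧ βu = -1 ∧ yu = -u) ∨ (u = 0 ∧ αu = 1 ∧ βu = 1 ∧ yu = 0))
    (hm : 0 ≤ m)
    (p1 : 2 * p ≤ 4 * m + 3 + αs + αt + αu) (p2 : -2 * p ≤ 4 * m + 3 + βs + βt + βu)
    (r1 : 2 * r ≤ 4 * m + 3 + αs + αt + αu) (r2 : -2 * r ≤ 4 * m + 3 + βs + βt + βu)
    (s1 : 2 * s ≤ 4 * m + 2 + βp + βr) (s2 : -2 * s ≤ 4 * m + 2 + αp + αr)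
    (t1 : 2 * t ≤ 4 * m + 3 + βp + βr + αu) (t2 : -2 * t ≤ 4 * m + 3 + αp + αr + βu)
    (u1 : 2 * u ≤ 4 * m + 3 + βp + βr + βt) (u2 : -2 * u ≤ 4 * m + 3 + αp + αr + αt)
    (pr1 : p - r ≤ 4 * m + 3) (pr2 : r - p ≤ 4 * m + 3)
    (pt1 : 2 * p - 2 * t ≤ 8 * m + 6 + αr + αs) (pt2 : 2 * t - 2 * p ≤ 8 * m + 6 + βr + βs)
    (rt1 : 2 * r - 2 * t ≤ 8 * m + 6 + αp + αs) (rt2 : 2 * t - 2 * r ≤ 8 * m + 6 + βp + βs)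
    (pu1 : 2 * p + 2 * u ≤ 8 * m + 6 + βr + αs) (pu2 : -2 * p - 2 * u ≤ 8 * m + 6 + αr + βs)
    (ru1 : 2 * r + 2 * u ≤ 8 * m + 6 + βp + αs) (ru2 : -2 * r - 2 * u ≤ 8 * m + 6 + αp + βs)
    (st1 : 2 * s - 2 * t ≤ 8 * m + 5 + βu) (st2 : 2 * t - 2 * s ≤ 8 * m + 5 + αu)
    (su1 : 2 * s - 2 * u ≤ 8 * m + 5 + αt) (su2 : 2 * u - 2 * s ≤ 8 * m + 5 + βt)
    (tu1 : t - u ≤ 4 * m + 3) (tu2 : u - t ≤ 4 * m + 3)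
    (pus1 : 2 * p + 2 * u - 2 * s ≤ 12 * m + 8) (pus2 : 2 * s - 2 * p - 2 * u ≤ 12 * m + 8)
    (rus1 : 2 * r + 2 * u - 2 * s ≤ 12 * m + 8) (rus2 : 2 * s - 2 * r - 2 * u ≤ 12 * m + 8)
    (pts1 : 2 * p - 2 * t + 2 * s ≤ 12 * m + 8) (pts2 : 2 * t - 2 * p - 2 * s ≤ 12 * m + 8)
    (rts1 : 2 * r - 2 * t + 2 * s ≤ 12 * m + 8) (rts2 : 2 * t - 2 * r - 2 * s ≤ 12 * m + 8)
    (hne : ∀ ep, ((ep = 1 ∧ 0 ≤ p) ∨ (ep = -1 ∧ p ≤ 0)) →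
      ∀ er, ((er = 1 ∧ 0 ≤ r) ∨ (er = -1 ∧ r ≤ 0)) →
      ∀ es, ((es = 1 ∧ 0 ≤ s) ∨ (es = -1 ∧ s ≤ 0)) → ∀ et, ((et = 1 ∧ 0 ≤ t) ∨ (et = -1 ∧ t ≤ 0)) →
      ∀ eu, ((eu = 1 ∧ 0 ≤ u) ∨ (eu = -1 ∧ u ≤ 0)) →
      (4 * m + 3 - ep * (es + et + eu) < 2 * yp ∨ 4 * m + 3 - er * (es + et + eu) < 2 * yr ∨
       4 * m + 2 + es * (ep + er) < 2 * ys ∨ 4 * m + 3 + et * (ep + er - eu) < 2 * yt ∨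
       4 * m + 3 + eu * (ep + er + et) < 2 * yu)) : False := by
  -- If no coordinate vanishes, `p1` to `u2` are exactly the box inequalities of the vector's own
  -- orthant. A zero coordinate lies in both adjacent orthants, so `hne` is kept for both signs; the
  -- bounds in several coordinates then show that some choice of signs works.
  rcases hp with ⟨xp, rfl, rfl, rfl⟩ | ⟨xp, rfl, rfl, rfl⟩ | ⟨rfl, rfl, rfl, rfl⟩ <;>
    first
    | replace hne := hne 1 (.inl ⟨rfl, xp.le⟩)
    | replace hne := hne (-1) (.inr ⟨rfl, xp.le⟩)
    | replace hne := fun er hr es hs et ht eu hu => And.intro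
        (hne 1 (.inl ⟨rfl, le_rfl⟩) er hr es hs et ht eu hu)
        (hne (-1) (.inr ⟨rfl, le_rfl⟩) er hr es hs et ht eu hu)
  all_goals (rcases hr with ⟨xr, rfl, rfl, rfl⟩ | ⟨xr, rfl, rfl, rfl⟩ | ⟨rfl, rfl, rfl, rfl⟩ <;>
    first
    | replace hne := hne 1 (.inl ⟨rfl, xr.le⟩)
    | replace hne := hne (-1) (.inr ⟨rfl, xr.le⟩)
    | replace hne := fun es hs et ht eu hu => And.intro
        (hne 1 (.inl ⟨rfl, le_rfl⟩) es hs et ht eu hu)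
        (hne (-1) (.inr ⟨rfl, le_rfl⟩) es hs et ht eu hu))
  all_goals (rcases hs with ⟨xs, rfl, rfl, rfl⟩ | ⟨xs, rfl, rfl, rfl⟩ | ⟨rfl, rfl, rfl, rfl⟩ <;>
    first
    | replace hne := hne 1 (.inl ⟨rfl, xs.le⟩)
    | replace hne := hne (-1) (.inr ⟨rfl, xs.le⟩)
    | replace hne := fun et ht eu hu => And.intro
        (hne 1 (.inl ⟨rfl, le_rfl⟩) et ht eu hu)
        (hne (-1) (.inr ⟨rfl, le_rfl⟩) et ht eu hu))
  all_goals (rcases ht with ⟨xt, rfl, rfl, rfl⟩ | ⟨xt, rfl, rfl, rfl⟩ | ⟨rfl, rfl, rfl, rfl⟩ <;>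
    first
    | replace hne := hne 1 (.inl ⟨rfl, xt.le⟩)
    | replace hne := hne (-1) (.inr ⟨rfl, xt.le⟩)
    | replace hne := fun eu hu => And.intro
        (hne 1 (.inl ⟨rfl, le_rfl⟩) eu hu)
        (hne (-1) (.inr ⟨rfl, le_rfl⟩) eu hu))
  all_goals (rcases hu with ⟨xu, rfl, rfl, rfl⟩ | ⟨xu, rfl, rfl, rfl⟩ | ⟨rfl, rfl, rfl, rfl⟩ <;>
    first
    | replace hne := hne 1 (.inl ⟨rfl, xu.le⟩)
    | replace hne := hne (-1) (.inr ⟨rfl, xu.le⟩)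
    | replace hne := And.intro
        (hne 1 (.inl ⟨rfl, le_rfl⟩))
        (hne (-1) (.inr ⟨rfl, le_rfl⟩)))
  all_goals omega

theorem IsShortest.neg {m p r s t u : ℤ} (h : IsShortest m p r s t u) :
    IsShortest m (-p) (-r) (-s) (-t) (-u) := by
  intro cp cr cs ct cu w
  have := h (-cp) (-cr) (-cs) (-ct) (-cu) (-w)
  simp only [abs_neg]
  refine this.trans (le_of_eq ?_)
  congr 1
  · congr 1
    · congr 1
      · congr 1 <;> rw [← abs_neg] <;> congr 1 <;> ring
      · rw [← abs_neg]; congr 1; ring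
    · rw [← abs_neg]; congr 1; ring
  · rw [← abs_neg]; congr 1; ring

/-- Exchanging `p` and `r` swaps `b_p` with `b_r` and fixes the other generators of the lattice. -/
theorem IsShortest.swap {m p r s t u : ℤ} (h : IsShortest m p r s t u) :
    IsShortest m r p s t u := by
  intro cp cr cs ct cu w
  have := h cr cp cs ct cu w
  rw [add_comm cp cr, add_comm |r| |p|]
  linarith

/-- For `z ≤ d` the right-hand absolute value opens as `d - z`; `hd` rules out `z > d`. -/
theorem two_mul_le_of_abs_add_le {z d a b : ℤ} (h : |z| + a ≤ |z - d| + b) (hd : b - a < d) :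
    2 * z ≤ d + (b - a) := by
  rcases le_total z d with hz | hz
  · rw [abs_of_nonpos (sub_nonpos.2 hz)] at h
    linarith [le_abs_self z]
  · rw [abs_of_nonneg (sub_nonneg.2 hz)] at h
    linarith [le_abs_self z]

theorem abs_sub_one_le (z : ℤ) : |z - 1| ≤ |z| + 1 := by simpa using abs_sub z 1

theorem abs_add_one_le (z : ℤ) : |z + 1| ≤ |z| + 1 := by simpa using abs_add_le z 1

theorem IsShortest.add_le {m p r s t u p' r' s' t' u' : ℤ} (h : IsShortest m p r s t u)
    (cp cr cs ct cu : ℤ)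
    (hp : p' = p - ((4 * m + 3) * cp - cs - ct - cu))
    (hr : r' = r - ((4 * m + 3) * cr - cs - ct - cu))
    (hs : s' = s - (cp + cr + (4 * m + 2) * cs))
    (ht : t' = t - (cp + cr + (4 * m + 3) * ct - cu))
    (hu : u' = u - (cp + cr + ct + (4 * m + 3) * cu)) :
    |p| + |r| + |s| + |t| + |u| ≤ |p'| + |r'| + |s'| + |t'| + |u'| := by
  subst hp hr hs ht hu
  simpa using h cp cr cs ct cu 0

/-- Each bound compares the vector with its translate by a single `bᵢ`. The bounds for `r` and the
lower bounds follow by `swap` and `neg`. -/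
theorem IsShortest.single_bounds {m p r s t u : ℤ} (hm : 1 ≤ m) (h : IsShortest m p r s t u) :
    2 * p ≤ 4 * m + 3 + (|s - 1| - |s|) + (|t - 1| - |t|) + (|u - 1| - |u|) ∧
    2 * s ≤ 4 * m + 2 + (|p + 1| - |p|) + (|r + 1| - |r|) ∧
    2 * t ≤ 4 * m + 3 + (|p + 1| - |p|) + (|r + 1| - |r|) + (|u - 1| - |u|) ∧
    2 * u ≤ 4 * m + 3 + (|p + 1| - |p|) + (|r + 1| - |r|) + (|t + 1| - |t|) := by
  have := abs_add_one_le p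
  have := abs_add_one_le r
  have := abs_sub_one_le s
  have := abs_sub_one_le t
  have := abs_add_one_le t
  have := abs_sub_one_le u
  refine ⟨?_, ?_, ?_, ?_⟩
  · have := h.add_le (p' := p - (4 * m + 3)) (r' := r) (s' := s - 1) (t' := t - 1) (u' := u - 1)
      1 0 0 0 0 (by ring) (by ring) (by ring) (by ring) (by ring)
    have := two_mul_le_of_abs_add_le (z := p) (d := 4 * m + 3) (a := |s| + |t| + |u|)
      (b := |s - 1| + |t - 1| + |u - 1|) (by linarith) (by linarith)
    linarith
  · have := h.add_le (p' := p + 1) (r' := r + 1) (s' := s - (4 * m + 2)) (t' := t) (u' := u)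
      0 0 1 0 0 (by ring) (by ring) (by ring) (by ring) (by ring)
    have := two_mul_le_of_abs_add_le (z := s) (d := 4 * m + 2) (a := |p| + |r|)
      (b := |p + 1| + |r + 1|) (by linarith) (by linarith)
    linarith
  · have := h.add_le (p' := p + 1) (r' := r + 1) (s' := s) (t' := t - (4 * m + 3)) (u' := u - 1)
      0 0 0 1 0 (by ring) (by ring) (by ring) (by ring) (by ring)
    have := two_mul_le_of_abs_add_le (z := t) (d := 4 * m + 3) (a := |p| + |r| + |u|)
      (b := |p + 1| + |r + 1| + |u - 1|) (by linarith) (by linarith)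
    linarith
  · have := h.add_le (p' := p + 1) (r' := r + 1) (s' := s) (t' := t + 1) (u' := u - (4 * m + 3))
      0 0 0 0 1 (by ring) (by ring) (by ring) (by ring) (by ring)
    have := two_mul_le_of_abs_add_le (z := u) (d := 4 * m + 3) (a := |p| + |r| + |t|)
      (b := |p + 1| + |r + 1| + |t + 1|) (by linarith) (by linarith)
    linarith

theorem IsShortest.abs_le {m p r s t u : ℤ} (hm : 1 ≤ m) (h : IsShortest m p r s t u) :
    |p| ≤ 2 * m + 3 ∧ |r| ≤ 2 * m + 3 ∧ |s| ≤ 2 * m + 2 ∧ |t| ≤ 2 * m + 3 ∧ |u| ≤ 2 * m + 3 := by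
  have key : ∀ {p r s t u : ℤ}, IsShortest m p r s t u →
      p ≤ 2 * m + 3 ∧ s ≤ 2 * m + 2 ∧ t ≤ 2 * m + 3 ∧ u ≤ 2 * m + 3 := by
    intro p r s t u h
    obtain ⟨h1, h2, h3, h4⟩ := h.single_bounds hm
    have := abs_add_one_le p
    have := abs_add_one_le r
    have := abs_sub_one_le s
    have := abs_sub_one_le t
    have := abs_add_one_le t
    have := abs_sub_one_le u
    refine ⟨?_, ?_, ?_, ?_⟩ <;> linarith
  have h1 := key h
  have h2 := key h.neg
  have h3 := key h.swap
  have h4 := key h.swap.neg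
  simp only [_root_.abs_le]
  omega

/-- The translates are by `b_p - b_r`, `b_p - b_t`, `b_p + b_u`, `b_s - b_t`, `b_s - b_u`, `b_t -
b_u`, `b_p - b_s + b_u` and `b_p + b_s - b_t`. The crude bounds of `abs_le` fix the sign of every
coordinate with a large shift. -/
theorem IsShortest.multiple_bounds {m p r s t u : ℤ} (hm : 1 ≤ m) (h : IsShortest m p r s t u) :
    p - r ≤ 4 * m + 3 ∧
    2 * p - 2 * t ≤ 8 * m + 6 + (|r - 1| - |r|) + (|s - 1| - |s|) ∧
    2 * p + 2 * u ≤ 8 * m + 6 + (|r + 1| - |r|) + (|s - 1| - |s|) ∧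
    2 * s - 2 * t ≤ 8 * m + 5 + (|u + 1| - |u|) ∧
    2 * s - 2 * u ≤ 8 * m + 5 + (|t - 1| - |t|) ∧
    t - u ≤ 4 * m + 3 ∧
    2 * p + 2 * u - 2 * s ≤ 12 * m + 8 ∧
    2 * p - 2 * t + 2 * s ≤ 12 * m + 8 := by
  obtain ⟨bp, br, bs, bt, bu⟩ := h.abs_le hm
  have := le_abs_self p
  have := neg_le_abs r
  have := le_abs_self s
  have := neg_le_abs s
  have := le_abs_self t
  have := neg_le_abs t
  have := le_abs_self u
  have := neg_le_abs u
  have pos : ∀ {z : ℤ}, 0 ≤ z → |z| = z := abs_of_nonneg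
  have npos : ∀ {z : ℤ}, z ≤ 0 → |z| = -z := abs_of_nonpos
  refine ⟨?_, ?_, ?_, ?_, ?_, ?_, ?_, ?_⟩
  · have := h.add_le (p' := p - (4 * m + 3)) (r' := r + (4 * m + 3)) (s' := s) (t' := t) (u' := u)
      1 (-1) 0 0 0 (by ring) (by ring) (by ring) (by ring) (by ring)
    rw [npos (z := p - _) (by linarith), pos (z := r + _) (by linarith)] at this
    linarith
  · have := h.add_le (p' := p - (4 * m + 4)) (r' := r - 1) (s' := s - 1) (t' := t + (4 * m + 2))
      (u' := u) 1 0 0 (-1) 0 (by ring) (by ring) (by ring) (by ring) (by ring)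
    rw [npos (z := p - _) (by linarith), pos (z := t + _) (by linarith)] at this
    linarith
  · have := h.add_le (p' := p - (4 * m + 2)) (r' := r + 1) (s' := s - 1) (t' := t)
      (u' := u - (4 * m + 4)) 1 0 0 0 1 (by ring) (by ring) (by ring) (by ring) (by ring)
    rw [npos (z := p - _) (by linarith), npos (z := u - _) (by linarith)] at this
    linarith
  · have := h.add_le (p' := p) (r' := r) (s' := s - (4 * m + 2)) (t' := t + (4 * m + 3))
      (u' := u + 1) 0 0 1 (-1) 0 (by ring) (by ring) (by ring) (by ring) (by ring)
    rw [npos (z := s - _) (by linarith), pos (z := t + _) (by linarith)] at this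
    linarith
  · have := h.add_le (p' := p) (r' := r) (s' := s - (4 * m + 2)) (t' := t - 1)
      (u' := u + (4 * m + 3)) 0 0 1 0 (-1) (by ring) (by ring) (by ring) (by ring) (by ring)
    rw [npos (z := s - _) (by linarith), pos (z := u + _) (by linarith)] at this
    linarith
  · have := h.add_le (p' := p) (r' := r) (s' := s) (t' := t - (4 * m + 4))
      (u' := u + (4 * m + 2)) 0 0 0 1 (-1) (by ring) (by ring) (by ring) (by ring) (by ring)
    rw [npos (z := t - _) (by linarith), pos (z := u + _) (by linarith)] at this
    linarith
  · have := h.add_le (p' := p - (4 * m + 3)) (r' := r) (s' := s + (4 * m + 1)) (t' := t)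
      (u' := u - (4 * m + 4)) 1 0 (-1) 0 1 (by ring) (by ring) (by ring) (by ring) (by ring)
    rw [npos (z := p - _) (by linarith), npos (z := u - _) (by linarith),
      pos (z := s + _) (by linarith)] at this
    linarith
  · have := h.add_le (p' := p - (4 * m + 3)) (r' := r) (s' := s - (4 * m + 3))
      (t' := t + (4 * m + 2)) (u' := u) 1 0 1 (-1) 0
      (by ring) (by ring) (by ring) (by ring) (by ring)
    rw [npos (z := p - _) (by linarith), npos (z := s - _) (by linarith),
      pos (z := t + _) (by linarith)] at this
    linarith

theorem sign_trichotomy (z : ℤ) :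
    (0 < z ∧ |z - 1| - |z| = -1 ∧ |z + 1| - |z| = 1 ∧ |z| = z) ∨
    (z < 0 ∧ |z - 1| - |z| = 1 ∧ |z + 1| - |z| = -1 ∧ |z| = -z) ∨
    (z = 0 ∧ |z - 1| - |z| = 1 ∧ |z + 1| - |z| = 1 ∧ |z| = 0) := by
  rcases lt_trichotomy z 0 with h | rfl | h
  · right; left
    rw [abs_of_neg h, abs_of_neg (by omega : z - 1 < 0), abs_of_nonpos (by omega : z + 1 ≤ 0)]
    omega
  · simp
  · left
    rw [abs_of_pos h, abs_of_nonneg (by omega : 0 ≤ z - 1), abs_of_pos (by omega : 0 < z + 1)]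
    omega

/-- In the box between `0` and a lattice vector of norm `10 * m + 7`, a shortest vector has at most
half that norm. -/
theorem IsShortest.norm_le_of_signs {m p r s t u ep er es et eu : ℤ}
    (h : IsShortest m p r s t u)
    (hp : ep = 1 ∧ 0 ≤ p ∨ ep = -1 ∧ p ≤ 0) (hr : er = 1 ∧ 0 ≤ r ∨ er = -1 ∧ r ≤ 0)
    (hs : es = 1 ∧ 0 ≤ s ∨ es = -1 ∧ s ≤ 0) (ht : et = 1 ∧ 0 ≤ t ∨ et = -1 ∧ t ≤ 0)
    (hu : eu = 1 ∧ 0 ≤ u ∨ eu = -1 ∧ u ≤ 0)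
    (bp : 2 * |p| ≤ 4 * m + 3 - ep * (es + et + eu))
    (br : 2 * |r| ≤ 4 * m + 3 - er * (es + et + eu))
    (bs : 2 * |s| ≤ 4 * m + 2 + es * (ep + er))
    (bt : 2 * |t| ≤ 4 * m + 3 + et * (ep + er - eu))
    (bu : 2 * |u| ≤ 4 * m + 3 + eu * (ep + er + et)) :
    |p| + |r| + |s| + |t| + |u| ≤ 5 * m + 3 := by
  have half : ∀ {e z : ℤ}, (e = 1 ∧ 0 ≤ z ∨ e = -1 ∧ z ≤ 0) →
      ∃ c, e = 2 * c + 1 ∧ c * (c + 1) = 0 ∧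
        ∀ v, 2 * |z| ≤ e * (2 * v) → |z - v| = e * v - |z| := by
    rintro e z (⟨rfl, hz⟩ | ⟨rfl, hz⟩)
    · refine ⟨0, by norm_num, by norm_num, fun v hv => ?_⟩
      rw [abs_of_nonneg hz] at hv ⊢
      rw [abs_of_nonpos (by linarith)]
      ring
    · refine ⟨-1, by norm_num, by norm_num, fun v hv => ?_⟩
      rw [abs_of_nonpos hz] at hv ⊢
      rw [abs_of_nonneg (by linarith)]
      ring
  obtain ⟨cp, ep_eq, qp, fp⟩ := half hp
  obtain ⟨cr, er_eq, qr, fr⟩ := half hr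
  obtain ⟨cs, es_eq, qs, fs⟩ := half hs
  obtain ⟨ct, et_eq, qt, ft⟩ := half ht
  obtain ⟨cu, eu_eq, qu, fu⟩ := half hu
  -- With `cᵢ = (εᵢ - 1)/2` and one copy of the half-sum, the lattice vector is `½ ∑ εᵢ bᵢ`.
  have key := h cp cr cs ct cu 1
  subst ep_eq er_eq es_eq et_eq eu_eq
  rw [fp _ (bp.trans (le_of_eq (by linear_combination (-(16 * m + 12)) * qp))),
    fr _ (br.trans (le_of_eq (by linear_combination (-(16 * m + 12)) * qr))),
    fs _ (bs.trans (le_of_eq (by linear_combination (-(16 * m + 8)) * qs))),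
    ft _ (bt.trans (le_of_eq (by linear_combination (-(16 * m + 12)) * qt))),
    fu _ (bu.trans (le_of_eq (by linear_combination (-(16 * m + 12)) * qu)))] at key
  have total : (2 * cp + 1) * ((4 * m + 3) * cp - cs - ct - cu + 2 * m * 1) +
      (2 * cr + 1) * ((4 * m + 3) * cr - cs - ct - cu + 2 * m * 1) +
      (2 * cs + 1) * (cp + cr + (4 * m + 2) * cs + (2 * m + 2) * 1) +
      (2 * ct + 1) * (cp + cr + (4 * m + 3) * ct - cu + (2 * m + 2) * 1) +
      (2 * cu + 1) * (cp + cr + ct + (4 * m + 3) * cu + (2 * m + 3) * 1) = 10 * m + 7 := by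
    linear_combination (8 * m + 6) * (qp + qr + qt + qu) + (8 * m + 4) * qs
  omega

theorem IsShortest.norm_le {m p r s t u : ℤ} (hm : 1 ≤ m) (h : IsShortest m p r s t u) :
    |p| + |r| + |s| + |t| + |u| ≤ 5 * m + 3 := by
  by_contra hN
  obtain ⟨p1, s1, t1, u1⟩ := h.single_bounds hm
  obtain ⟨r1, -⟩ := h.swap.single_bounds hm
  obtain ⟨p2, s2, t2, u2⟩ := h.neg.single_bounds hm
  obtain ⟨r2, -⟩ := h.swap.neg.single_bounds hm
  obtain ⟨pr1, pt1, pu1, st1, su1, tu1, pus1, pts1⟩ := h.multiple_bounds hm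
  obtain ⟨pr2, pt2, pu2, st2, su2, tu2, pus2, pts2⟩ := h.neg.multiple_bounds hm
  obtain ⟨-, rt1, ru1, -, -, -, rus1, rts1⟩ := h.swap.multiple_bounds hm
  obtain ⟨-, rt2, ru2, -, -, -, rus2, rts2⟩ := h.swap.neg.multiple_bounds hm
  have e1 : ∀ z : ℤ, |-z - 1| = |z + 1| := fun z => by rw [← abs_neg]; congr 1; ring
  have e2 : ∀ z : ℤ, |-z + 1| = |z - 1| := fun z => by rw [← abs_neg]; congr 1; ring
  simp only [e1, e2, abs_neg] at p2 s2 t2 u2 r2 pr2 pt2 pu2 st2 su2 tu2 pus2 pts2 rt2 ru2 rus2 rts2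
  refine false_of_bounds_of_forall_orthant m p r s t u _ _ _ _ _ _ _ _ _ _ _ _ _ _ _
    (sign_trichotomy p) (sign_trichotomy r) (sign_trichotomy s) (sign_trichotomy t)
    (sign_trichotomy u) (by linarith) p1 (by linarith) r1 (by linarith) s1 (by linarith) t1
    (by linarith) u1 (by linarith) pr1 (by linarith) pt1 (by linarith) rt1 (by linarith) pu1
    (by linarith) ru1 (by linarith) st1 (by linarith) su1 (by linarith) tu1 (by linarith) pus1
    (by linarith) rus1 (by linarith) pts1 (by linarith) rts1 (by linarith) ?_
  intro ep hp er hr es hs et ht eu hu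
  by_contra hbox
  push Not at hbox
  exact hN (h.norm_le_of_signs hp hr hs ht hu hbox.1 hbox.2.1 hbox.2.2.1 hbox.2.2.2.1
    hbox.2.2.2.2)

/-! ### Lower bound: a deep hole of the lattice -/

/-- Take `φ` opposite to the sign of `c`: then `-c(Dφ + κ) ≥ |c|(D - d) ≥ 2|y|`, which outweighs `φy
≥ -|y|`. For `c = 0` take the sign of `y`. -/
theorem exists_sign_le_mul_sub {y c D d : ℤ} (h : 2 * |y| ≤ D - d) :
    ∃ φ : ℤ, (φ = 1 ∨ φ = -1) ∧ ∀ κ, |κ| ≤ d → |y| ≤ φ * y - c * (D * φ + κ) := by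
  have h1 := le_abs_self y
  have h2 := neg_le_abs y
  rcases lt_trichotomy c 0 with hc | rfl | hc
  · refine ⟨1, .inl rfl, fun κ hκ => ?_⟩
    have := neg_le_of_abs_le hκ
    nlinarith [mul_le_mul_of_nonneg_left (by linarith : 2 * |y| ≤ D + κ) (by omega : 0 ≤ -c - 1)]
  · rcases le_total 0 y with hy | hy
    · exact ⟨1, .inl rfl, fun κ _ => by rw [abs_of_nonneg hy]; simp⟩
    · exact ⟨-1, .inr rfl, fun κ _ => by rw [abs_of_nonpos hy]; simp⟩
  · refine ⟨-1, .inr rfl, fun κ hκ => ?_⟩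
    have := le_of_abs_le hκ
    nlinarith [mul_le_mul_of_nonneg_left (by linarith : 2 * |y| ≤ D - κ) (by omega : 0 ≤ c - 1)]

/-- Testing the translate against a sign vector `φ` bounds its norm from below. Regrouped by basis
vectors, the pairing has one term per `c`, where `κ` collects the off-diagonal entries of `bᵢ · φ`;
so each sign can be chosen separately, uniformly in the others. -/
theorem norm_le_norm_sub {m p r s t u : ℤ} (hp : |p| ≤ 2 * m) (hr : |r| ≤ 2 * m)
    (hs : |s| ≤ 2 * m) (ht : |t| ≤ 2 * m) (hu : |u| ≤ 2 * m) (cp cr cs ct cu : ℤ) :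
    |p| + |r| + |s| + |t| + |u| ≤
      |p - ((4 * m + 3) * cp - cs - ct - cu)| + |r - ((4 * m + 3) * cr - cs - ct - cu)| +
      |s - (cp + cr + (4 * m + 2) * cs)| + |t - (cp + cr + (4 * m + 3) * ct - cu)| +
      |u - (cp + cr + ct + (4 * m + 3) * cu)| := by
  obtain ⟨φp, hφp, kp⟩ := exists_sign_le_mul_sub (y := p) (c := cp) (D := 4 * m + 3) (d := 3)
    (by linarith)
  obtain ⟨φr, hφr, kr⟩ := exists_sign_le_mul_sub (y := r) (c := cr) (D := 4 * m + 3) (d := 3)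
    (by linarith)
  obtain ⟨φs, hφs, ks⟩ := exists_sign_le_mul_sub (y := s) (c := cs) (D := 4 * m + 2) (d := 2)
    (by linarith)
  obtain ⟨φt, hφt, kt⟩ := exists_sign_le_mul_sub (y := t) (c := ct) (D := 4 * m + 3) (d := 3)
    (by linarith)
  obtain ⟨φu, hφu, ku⟩ := exists_sign_le_mul_sub (y := u) (c := cu) (D := 4 * m + 3) (d := 3)
    (by linarith)
  have kp := kp (φs + φt + φu) (by rw [abs_le]; omega)
  have kr := kr (φs + φt + φu) (by rw [abs_le]; omega)
  have ks := ks (-φp - φr) (by rw [abs_le]; omega)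
  have kt := kt (-φp - φr + φu) (by rw [abs_le]; omega)
  have ku := ku (-φp - φr - φt) (by rw [abs_le]; omega)
  have sign_mul_le : ∀ {φ : ℤ} (_ : φ = 1 ∨ φ = -1) (z : ℤ), φ * z ≤ |z| := by
    rintro φ (rfl | rfl) z
    · simpa using le_abs_self z
    · simpa using neg_le_abs z
  have jp := sign_mul_le hφp (p - ((4 * m + 3) * cp - cs - ct - cu))
  have jr := sign_mul_le hφr (r - ((4 * m + 3) * cr - cs - ct - cu))
  have js := sign_mul_le hφs (s - (cp + cr + (4 * m + 2) * cs))
  have jt := sign_mul_le hφt (t - (cp + cr + (4 * m + 3) * ct - cu))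
  have ju := sign_mul_le hφu (u - (cp + cr + ct + (4 * m + 3) * cu))
  linarith

/-- The vector `(m, -(m+1), m, m+1, -(m+1))` is a deep hole: no lattice vector is closer to it
than `0`. -/
theorem le_norm_deepHole_sub {m : ℤ} (hm : 1 ≤ m) (cp cr cs ct cu w : ℤ) :
    5 * m + 3 ≤
      |m - ((4 * m + 3) * cp - cs - ct - cu + 2 * m * w)| +
      |-(m + 1) - ((4 * m + 3) * cr - cs - ct - cu + 2 * m * w)| +
      |m - (cp + cr + (4 * m + 2) * cs + (2 * m + 2) * w)| +
      |m + 1 - (cp + cr + (4 * m + 3) * ct - cu + (2 * m + 2) * w)| +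
      |-(m + 1) - (cp + cr + ct + (4 * m + 3) * cu + (2 * m + 3) * w)| := by
  have a0 : |m| = m := abs_of_nonneg (by linarith)
  have a1 : |m + 1| = m + 1 := abs_of_nonneg (by linarith)
  obtain ⟨v, rfl | rfl⟩ := Int.even_or_odd' w
  · have := norm_le_norm_sub (m := m) (p := m) (r := -(m + 1)) (s := m) (t := m + 1)
      (u := -(m + 1)) (by linarith) (by rw [abs_neg]; linarith) (by linarith) (by linarith)
      (by rw [abs_neg]; linarith) (cp + v) (cr + v) (cs + v) (ct + v) (cu + v)
    rw [abs_neg, a0, a1] at this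
    refine (by linarith : 5 * m + 3 ≤ _).trans (this.trans (le_of_eq ?_))
    congr 1
    · congr 1
      · congr 1
        · congr 1 <;> congr 1 <;> ring
        · congr 1; ring
      · congr 1; ring
    · congr 1; ring
  -- For odd `w`, subtract from the hole the vector `½(b_p - b_r + b_s + b_t - b_u)` of its own
  -- orthant; this leaves norm `(10m + 7) - (5m + 3) = 5m + 4`. The two negative signs account for
  -- the `+ 1` in the coefficients of `b_r` and `b_u`.
  · have := norm_le_norm_sub (m := m) (p := -(m + 1)) (r := m + 1) (s := -(m + 1)) (t := -(m + 1))
      (u := m) (by rw [abs_neg]; linarith) (by linarith) (by rw [abs_neg]; linarith)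
      (by rw [abs_neg]; linarith) (by linarith)
      (cp + v) (cr + v + 1) (cs + v) (ct + v) (cu + v + 1)
    rw [abs_neg, a0, a1] at this
    refine (by linarith : 5 * m + 3 ≤ _).trans (this.trans (le_of_eq ?_))
    congr 1
    · congr 1
      · congr 1
        · congr 1 <;> congr 1 <;> ring
        · congr 1; ring
      · congr 1; ring
    · congr 1; ring

/-! ### The generators and their lattice of relations -/

/-- The order of the circulant graph of diameter `5 * m + 3`. -/
def circulantOrder (m : ℕ) : ℕ :=
  512 * m ^ 5 + 1792 * m ^ 4 + 2720 * m ^ 3 + 2192 * m ^ 2 + 916 * m + 156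

/-- The generators of the circulant graph of diameter `5 * m + 3`. -/
def circulantGen (m : ℕ) : Fin 5 → ℤ :=
  ![1, 128 * m ^ 4 + 320 * m ^ 3 + 344 * m ^ 2 + 168 * m + 27,
    256 * m ^ 4 + 704 * m ^ 3 + 832 * m ^ 2 + 472 * m + 103,
    256 * m ^ 4 + 736 * m ^ 3 + 896 * m ^ 2 + 526 * m + 120,
    384 * m ^ 4 + 1056 * m ^ 3 + 1240 * m ^ 2 + 698 * m + 150]

/-- The integer combination of the generators with coefficients `(p, s, -r, t, -u)`. -/
def genCombination (m : ℕ) (p r s t u : ℤ) : ℤ :=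
  p * circulantGen m 0 + s * circulantGen m 1 - r * circulantGen m 2 + t * circulantGen m 3 -
    u * circulantGen m 4

/-- On `b_p, b_r, b_s, b_t, b_u` and the half-sum the combination takes the values `0, -2, 1, 2, -3`
and `-1` times `n`. -/
theorem genCombination_lattice (m : ℕ) (cp cr cs ct cu w : ℤ) :
    genCombination m ((4 * m + 3) * cp - cs - ct - cu + 2 * m * w)
      ((4 * m + 3) * cr - cs - ct - cu + 2 * m * w)
      (cp + cr + (4 * m + 2) * cs + (2 * m + 2) * w)
      (cp + cr + (4 * m + 3) * ct - cu + (2 * m + 2) * w)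
      (cp + cr + ct + (4 * m + 3) * cu + (2 * m + 3) * w) =
    circulantOrder m * (-2 * cr + cs + 2 * ct - 3 * cu - w) := by
  simp only [genCombination, circulantGen, circulantOrder, Matrix.cons_val]
  push_cast
  ring

theorem exists_lattice_of_dvd_genCombination {m : ℕ} {p r s t u : ℤ}
    (h : (circulantOrder m : ℤ) ∣ genCombination m p r s t u) :
    ∃ cp cr cs ct cu w : ℤ, p = (4 * m + 3) * cp - cs - ct - cu + 2 * m * w ∧
      r = (4 * m + 3) * cr - cs - ct - cu + 2 * m * w ∧
      s = cp + cr + (4 * m + 2) * cs + (2 * m + 2) * w ∧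
      t = cp + cr + (4 * m + 3) * ct - cu + (2 * m + 2) * w ∧
      u = cp + cr + ct + (4 * m + 3) * cu + (2 * m + 3) * w := by
  obtain ⟨Q, hQ⟩ := h
  simp only [genCombination, circulantGen, circulantOrder, Matrix.cons_val] at hQ
  push_cast at hQ
  -- Only the parity of `w` matters, and it is that of `t + u`, so `w = t + u` is allowed; the other
  -- coefficients then solve the linear system. Since the first generator is `1`, `hQ` is needed
  -- only for `p`.
  refine ⟨(128 * m ^ 4 + 352 * m ^ 3 + 392 * m ^ 2 + 204 * m + 41) * Q + (64 * m ^ 3 +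
    128 * m ^ 2 + 100 * m + 27) * r + (-32 * m ^ 3 - 56 * m ^ 2 - 38 * m - 7) * s +
      (-64 * m ^ 3 - 136 * m ^ 2 - 110 * m - 32) * t + (96 * m ^ 3 + 192 * m ^ 2 + 148 * m +
        39) * u,
    (-24 * m ^ 2 - 32 * m - 11) * Q + (-12 * m - 7) * r + (6 * m + 2) * s + (12 * m + 8) * t +
      (-18 * m - 11) * u,
    (-32 * m ^ 3 - 72 * m ^ 2 - 56 * m - 15) * Q + (-16 * m ^ 2 - 24 * m - 10) * r + (8 * m ^ 2 +
      10 * m + 3) * s + (16 * m ^ 2 + 26 * m + 11) * t + (-24 * m ^ 2 - 36 * m - 15) * u,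
    (-32 * m ^ 3 - 72 * m ^ 2 - 52 * m - 12) * Q + (-16 * m ^ 2 - 24 * m - 8) * r + (8 * m ^ 2 +
      10 * m + 2) * s + (16 * m ^ 2 + 26 * m + 9) * t + (-24 * m ^ 2 - 36 * m - 12) * u,
    (-32 * m ^ 3 - 56 * m ^ 2 - 32 * m - 6) * Q + (-16 * m ^ 2 - 16 * m - 4) * r + (8 * m ^ 2 +
      6 * m + 1) * s + (16 * m ^ 2 + 18 * m + 4) * t + (-24 * m ^ 2 - 24 * m - 6) * u, t +
        u, ?_, ?_, ?_, ?_, ?_⟩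
  · linear_combination hQ
  all_goals ring

/-! ### Distances in circulant graphs as word lengths -/

theorem edist_add_le_one {n : ℕ} {S : Set (ZMod n)} {a : ZMod n}
    (ha : a ∈ connectionSet S) (u : ZMod n) : (circulantGraphOf S).edist u (u + a) ≤ 1 := by
  by_cases h : a = 0
  · simp [h]
  · refine (SimpleGraph.edist_eq_one_iff_adj.2 ?_).le
    rw [circulantGraphOf, SimpleGraph.circulantGraph, SimpleGraph.fromRel_adj]
    refine ⟨fun h' => h (by simpa using h'), .inr (by simpa using ha)⟩

theorem edist_add_zsmul_le {n : ℕ} {S : Set (ZMod n)} {a : ZMod n} (ha : a ∈ S) (z : ℤ)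
    (u : ZMod n) : (circulantGraphOf S).edist u (u + z * a) ≤ z.natAbs := by
  have key : ∀ (b : ZMod n), b ∈ connectionSet S → ∀ (j : ℕ) (u : ZMod n),
      (circulantGraphOf S).edist u (u + j * b) ≤ j := by
    intro b hb j
    induction j with
    | zero => simp
    | succ j ih =>
      intro u
      refine (SimpleGraph.edist_triangle (v := u + j * b)).trans ?_
      have := edist_add_le_one hb (u + j * b)
      rw [show u + j * b + b = u + (j + 1 : ℕ) * b by push_cast; ring] at this
      exact (add_le_add (ih u) this).trans (by push_cast; exact le_rfl)
  rcases Int.natAbs_eq z with hz | hz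
  · have := key a (.inl ha) z.natAbs u
    rwa [← Int.cast_natCast, ← hz] at this
  · have := key (-a) (.inr (by simpa using ha)) z.natAbs u
    rwa [mul_neg, ← neg_mul, ← Int.cast_natCast, ← Int.cast_neg, ← hz] at this

theorem edist_add_sum_le {n : ℕ} {ι : Type*} (g : ι → ZMod n) (x : ι → ℤ) (I : Finset ι)
    (u : ZMod n) : (circulantGraphOf (Set.range g)).edist u (u + ∑ i ∈ I, x i * g i) ≤
      (∑ i ∈ I, (x i).natAbs : ℕ) := by
  classical
  induction I using Finset.induction_on with
  | empty => simp
  | insert i I hi ih =>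
    rw [Finset.sum_insert hi, Finset.sum_insert hi, Nat.cast_add, add_comm (_ * _), ← add_assoc,
      add_comm (((x i).natAbs : ℕ) : ℕ∞)]
    exact SimpleGraph.edist_triangle.trans (add_le_add ih
      (edist_add_zsmul_le (Set.mem_range_self i) _ _))

theorem exists_sum_of_walk {n : ℕ} {ι : Type*} [Fintype ι] (g : ι → ZMod n) {u v : ZMod n}
    (w : (circulantGraphOf (Set.range g)).Walk u v) :
    ∃ x : ι → ℤ, ∑ i, (x i).natAbs ≤ w.length ∧ v = u + ∑ i, x i * g i := by
  classical
  induction w with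
  | nil => exact ⟨0, by simp, by simp⟩
  | @cons u u' v h w ih =>
    obtain ⟨x, hx, hv⟩ := ih
    rw [circulantGraphOf, SimpleGraph.circulantGraph, SimpleGraph.fromRel_adj] at h
    obtain ⟨i, e, he, hi⟩ : ∃ (i : ι) (e : ℤ), e.natAbs = 1 ∧ u' = u + e * g i := by
      rcases h.2 with (⟨i, hi⟩ | ⟨i, hi⟩) | (⟨i, hi⟩ | ⟨i, hi⟩)
      · exact ⟨i, -1, rfl, by simp only [hi]; push_cast; ring⟩
      · exact ⟨i, 1, rfl, by simp only [hi]; push_cast; ring⟩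
      · exact ⟨i, 1, rfl, by simp only [hi]; push_cast; ring⟩
      · exact ⟨i, -1, rfl, by simp only [hi]; push_cast; ring⟩
    refine ⟨x + (Pi.single i e : ι → ℤ), ?_, ?_⟩
    · rw [SimpleGraph.Walk.length_cons]
      calc ∑ j, ((x + (Pi.single i e : ι → ℤ)) j).natAbs
          ≤ ∑ j, ((x j).natAbs + (if j = i then 1 else 0)) := by
            refine Finset.sum_le_sum fun j _ => ?_
            rcases eq_or_ne j i with rfl | hj
            · simpa [he] using Int.natAbs_add_le (x j) e
            · simp [hj]
        _ = ∑ j, (x j).natAbs + 1 := by simp [Finset.sum_add_distrib]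
        _ ≤ _ := by omega
    · rw [hv, hi]
      have : ∑ j, ((x + (Pi.single i e : ι → ℤ)) j : ZMod n) * g j = ∑ j, x j * g j + e * g i := by
        have single : (e : ZMod n) * g i = ∑ j, if j = i then (e : ZMod n) * g j else 0 := by simp
        rw [single, ← Finset.sum_add_distrib]
        refine Finset.sum_congr rfl fun j _ => ?_
        rcases eq_or_ne j i with rfl | hj
        · simp [add_mul]
        · simp [hj]
      rw [this]
      ring

/-! ### Distinctness of the generators and the degree -/

theorem circulantGen_pos (m : ℕ) (i : Fin 5) : 0 < circulantGen m i := by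
  fin_cases i <;> simp only [circulantGen, Fin.reduceFinMk, Matrix.cons_val, Fin.zero_eta,
    Fin.mk_one] <;> positivity

theorem circulantGen_strictMono (m : ℕ) : StrictMono (circulantGen m) := by
  refine Fin.strictMono_iff_lt_succ.2 fun i => ?_
  fin_cases i <;> simp [circulantGen] <;> nlinarith [pow_nonneg (Int.natCast_nonneg m) 4,
    pow_nonneg (Int.natCast_nonneg m) 3, pow_nonneg (Int.natCast_nonneg m) 2]

/-- This reduces equalities between residues `±gᵢ` to integers. It fails at `m = 0`, where `2 · 150
> 156`. Substituting `m = 1 + j` makes all coefficients of the difference positive. -/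
theorem two_mul_circulantGen_lt {m : ℕ} (hm : 1 ≤ m) (i : Fin 5) :
    2 * circulantGen m i < circulantOrder m := by
  have h : circulantGen m i ≤ circulantGen m 4 :=
    (circulantGen_strictMono m).monotone (Fin.le_last i)
  obtain ⟨j, rfl⟩ := Nat.exists_eq_add_of_le hm
  have : 2 * circulantGen (1 + j) 4 < circulantOrder (1 + j) := by
    have eq : (circulantOrder (1 + j) : ℤ) = 2 * circulantGen (1 + j) 4 +
        (512 * j ^ 5 + 3584 * j ^ 4 + 9824 * j ^ 3 + 12800 * j ^ 2 + 7424 * j + 1232) := by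
      simp only [circulantGen, circulantOrder, Matrix.cons_val]
      push_cast
      ring
    rw [eq]
    exact lt_add_of_pos_right _ (by positivity)
  linarith

theorem intCast_circulantGen_injective (m : ℕ) :
    Function.Injective fun i => (circulantGen m i : ZMod (circulantOrder m)) := by
  rcases Nat.eq_zero_or_pos m with rfl | hm
  · decide +kernel
  intro i j hij
  have := (ZMod.intCast_eq_intCast_iff_dvd_sub _ _ _).1 hij
  refine (circulantGen_strictMono m).injective (sub_eq_zero.1
    (Int.eq_zero_of_abs_lt_dvd this ?_)).symm
  have := two_mul_circulantGen_lt hm i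
  have := two_mul_circulantGen_lt hm j
  have := circulantGen_pos m i
  have := circulantGen_pos m j
  rw [abs_lt]
  omega

theorem circulantGen_add_ne_zero (m : ℕ) (i j : Fin 5) :
    (circulantGen m i + circulantGen m j : ZMod (circulantOrder m)) ≠ 0 := by
  rcases Nat.eq_zero_or_pos m with rfl | hm
  · revert i j
    decide +kernel
  intro hij
  have hij : ((circulantGen m i + circulantGen m j : ℤ) : ZMod (circulantOrder m)) = 0 := by
    push_cast
    exact hij
  have := Int.le_of_dvd (add_pos (circulantGen_pos m i) (circulantGen_pos m j))
    ((ZMod.intCast_zmod_eq_zero_iff_dvd _ _).1 hij)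
  have := two_mul_circulantGen_lt hm i
  have := two_mul_circulantGen_lt hm j
  omega

theorem encard_neighborSet_circulantGraphOf {n : ℕ} {S : Set (ZMod n)}
    (hS : ∀ s ∈ S, -s ∉ S) (v : ZMod n) :
    ((circulantGraphOf S).neighborSet v).encard = S.encard + S.encard := by
  have h : (circulantGraphOf S).neighborSet v = (fun a => v + a) '' (S ∪ Neg.neg '' S) := by
    ext w
    rw [SimpleGraph.mem_neighborSet, circulantGraphOf, SimpleGraph.circulantGraph,
      SimpleGraph.fromRel_adj]
    simp only [connectionSet, Set.mem_ofPred_eq, neg_sub, Set.mem_image, Set.mem_union]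
    constructor
    · rintro ⟨-, (h | h) | (h | h)⟩
      · exact ⟨w - v, .inr ⟨_, h, by ring⟩, by ring⟩
      · exact ⟨w - v, .inl h, by ring⟩
      · exact ⟨w - v, .inl h, by ring⟩
      · exact ⟨w - v, .inr ⟨_, h, by ring⟩, by ring⟩
    · rintro ⟨a, ha | ⟨s, hs, rfl⟩, rfl⟩
      · refine ⟨fun h0 => ?_, .inr (.inl (by simpa using ha))⟩
        -- Since `-0 = 0`, `hS` also excludes `0` from `S`, so there are no loops to discard.
        have : a = 0 := by simpa using h0
        exact hS a ha (by simpa [this] using ha)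
      · refine ⟨fun h0 => ?_, .inl (.inl (by simpa using hs))⟩
        have : s = 0 := by simpa using h0
        exact hS s hs (by simpa [this] using hs)
  rw [h, (add_right_injective v).encard_image, Set.encard_union_eq, neg_injective.encard_image]
  rw [Set.disjoint_left]
  rintro a ha ⟨s, hs, rfl⟩
  exact hS s hs ha

/-! ### The diameter -/

theorem sum_mul_circulantGen (m : ℕ) (x : Fin 5 → ℤ) :
    ∑ i, x i * circulantGen m i = genCombination m (x 0) (-x 2) (x 1) (x 3) (-x 4) := by
  rw [Fin.sum_univ_five, genCombination]
  ring

theorem sum_natAbs_eq (x : Fin 5 → ℤ) :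
    ((∑ i, (x i).natAbs : ℕ) : ℤ) = |x 0| + |-x 2| + |x 1| + |x 3| + |-x 4| := by
  rw [Fin.sum_univ_five]
  push_cast
  rw [abs_neg, abs_neg]
  ring

theorem genCombination_sub (m : ℕ) (p r s t u p' r' s' t' u' : ℤ) :
    genCombination m (p - p') (r - r') (s - s') (t - t') (u - u') =
      genCombination m p r s t u - genCombination m p' r' s' t' u' := by
  simp only [genCombination]
  ring

theorem exists_sum_eq_of_one_le {m : ℕ} (hm : 1 ≤ m) (c : ZMod (circulantOrder m)) :
    ∃ x : Fin 5 → ℤ, ∑ i, (x i).natAbs ≤ 5 * m +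
      3 ∧ ∑ i, (x i : ZMod (circulantOrder m)) * circulantGen m i = c := by
  have hne : {x : Fin 5 →
    ℤ | ∑ i, (x i : ZMod (circulantOrder m)) * circulantGen m i = c}.Nonempty :=
    ⟨Pi.single 0 c.cast, by simp [Fin.sum_univ_five, circulantGen]⟩
  -- A representation of `c` of least norm is a shortest vector, because translating by the lattice
  -- does not change `c`.
  obtain ⟨x, hx, hmin⟩ := (measure fun x : Fin 5 → ℤ => ∑ i, (x i).natAbs).wf.has_min _ hne
  refine ⟨x, ?_, hx⟩
  have short : IsShortest m (x 0) (-x 2) (x 1) (x 3) (-x 4) := by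
    intro cp cr cs ct cu w
    have key := genCombination_lattice m cp cr cs ct cu w
    generalize (4 * m + 3) * cp - cs - ct - cu + 2 * m * w = p at *
    generalize (4 * m + 3) * cr - cs - ct - cu + 2 * m * w = r at *
    generalize cp + cr + (4 * m + 2) * cs + (2 * m + 2) * w = s at *
    generalize cp + cr + (4 * m + 3) * ct - cu + (2 * m + 2) * w = t at *
    generalize cp + cr + ct + (4 * m + 3) * cu + (2 * m + 3) * w = u at *
    have h := hmin ![x 0 - p, x 1 - s, x 2 + r, x 3 - t, x 4 + u] (by
      have e := sum_mul_circulantGen m ![x 0 - p, x 1 - s, x 2 + r, x 3 - t, x 4 + u]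
      have e' := sum_mul_circulantGen m x
      simp only [Matrix.cons_val] at e
      rw [neg_add', neg_add', genCombination_sub, key, ← e'] at e
      have e := congrArg (Int.cast : ℤ → ZMod (circulantOrder m)) e
      push_cast at e
      rw [Set.mem_ofPred_eq, e, ← hx]
      simp)
    have h : ∑ i, (x i).natAbs ≤ _ := Nat.le_of_not_lt h
    have h : ((∑ i, (x i).natAbs : ℕ) : ℤ) ≤ _ := Int.ofNat_le.2 h
    rw [sum_natAbs_eq] at h
    refine h.trans (le_of_eq ?_)
    rw [sum_natAbs_eq]
    simp only [Matrix.cons_val, neg_add']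
  have := short.norm_le (by exact_mod_cast hm)
  rw [← sum_natAbs_eq] at this
  exact_mod_cast this

theorem exists_sum_eq_zero (c : ZMod (circulantOrder 0)) :
    ∃ x : Fin 5 → ℤ, ∑ i, (x i).natAbs ≤ 3 ∧
      ∑ i, (x i : ZMod (circulantOrder 0)) * circulantGen 0 i = c := by
  -- Zero coefficients and repeated indices are allowed, so this covers all words of length at most
  -- three.
  have cover : ∀ c : Fin 156, ∃ i j l : Fin 5, ∃ e ∈ [-1, 0, 1], ∃ f ∈ [-1, 0, 1],
      ∃ h ∈ [-1, 0, 1], (e * circulantGen 0 i + f * circulantGen 0 j + h * circulantGen 0 l) % 156 =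
        (c : ℕ) := by
    decide +kernel
  obtain ⟨i, j, l, e, he, f, hf, h, hh, hc⟩ := cover c
  have bound : ∀ (i : Fin 5), ∀ e ∈ [-1, 0, 1], ∑ j, ((Pi.single i e : Fin 5 →
    ℤ) j).natAbs ≤ 1 := by
    decide
  refine ⟨Pi.single i e + Pi.single j f + Pi.single l h, ?_, ?_⟩
  · calc _ ≤ ∑ a, (((Pi.single i e : Fin 5 → ℤ) a).natAbs + ((Pi.single j f : Fin 5 → ℤ) a).natAbs +
          ((Pi.single l h : Fin 5 → ℤ) a).natAbs) := Finset.sum_le_sum fun a _ =>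
          (Int.natAbs_add_le _ _).trans (Nat.add_le_add_right (Int.natAbs_add_le _ _) _)
      _ ≤ 3 := by
        rw [Finset.sum_add_distrib, Finset.sum_add_distrib]
        have := bound i e he
        have := bound j f hf
        have := bound l h hh
        omega
  · have sum_single : ∀ (i : Fin 5) (e : ℤ),
        ∑ a, (Pi.single i e : Fin 5 → ℤ) a * circulantGen 0 a = e * circulantGen 0 i := by
      intro i e
      simp [Pi.single_apply]
    have hsum : ∑ a, (Pi.single i e + Pi.single j f + Pi.single l h : Fin 5 → ℤ) a *
        circulantGen 0 a = e * circulantGen 0 i + f * circulantGen 0 j + h * circulantGen 0 l := by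
      simp only [Pi.add_apply, add_mul, Finset.sum_add_distrib, sum_single]
    have key := congrArg (Int.cast : ℤ → ZMod (circulantOrder 0)) hsum
    rw [Int.cast_sum] at key
    simp only [Int.cast_mul] at key
    rw [key, ← ZMod.intCast_mod]
    refine (congrArg (Int.cast : ℤ → ZMod (circulantOrder 0)) hc).trans ?_
    rw [Int.cast_natCast]
    exact ZMod.natCast_zmod_val (n := 156) c

theorem exists_le_sum_natAbs (m : ℕ) : ∃ c : ZMod (circulantOrder m), ∀ x : Fin 5 → ℤ,
    ∑ i, (x i : ZMod (circulantOrder m)) * circulantGen m i = c → 5 * m +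
      3 ≤ ∑ i, (x i).natAbs := by
  rcases Nat.eq_zero_or_pos m with rfl | hm
  · have far : ∀ a ∈ Finset.Icc (-2 : ℤ) 2, ∀ b ∈ Finset.Icc (-2 : ℤ) 2,
        ∀ c ∈ Finset.Icc (-2 : ℤ) 2, ∀ d ∈ Finset.Icc (-2 : ℤ) 2, ∀ e ∈ Finset.Icc (-2 : ℤ) 2,
        a.natAbs + b.natAbs + c.natAbs + d.natAbs + e.natAbs ≤ 2 →
        (a + b * 27 + c * 103 + d * 120 + e * 150) % 156 ≠ 3 := by
      decide +kernel
    -- For `n = 156` the residue `3` is not a word of length at most two, by `far`.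
    refine ⟨3, fun x hx => ?_⟩
    by_contra hlt
    rw [Fin.sum_univ_five] at hx hlt
    have hx : ((x 0 + x 1 * 27 + x 2 * 103 + x 3 * 120 + x 4 * 150 : ℤ) :
        ZMod (circulantOrder 0)) = (3 : ℤ) := by
      rw [← Int.cast_ofNat] at hx
      rw [← hx]
      simp [circulantGen]
    rw [ZMod.intCast_eq_intCast_iff] at hx
    refine far (x 0) ?_ (x 1) ?_ (x 2) ?_ (x 3) ?_ (x 4) ?_ (by omega) hx
    all_goals
      rw [Finset.mem_Icc]
      omega
  -- This is the class of the deep hole; every other representation of it differs by a lattice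
  -- vector.
  refine ⟨(genCombination m m (-(m + 1)) m (m + 1) (-(m + 1)) : ℤ), fun x hx => ?_⟩
  have e := congrArg (Int.cast : ℤ → ZMod (circulantOrder m)) (sum_mul_circulantGen m x)
  push_cast at e
  rw [hx, ZMod.intCast_eq_intCast_iff_dvd_sub, ← neg_sub, dvd_neg, ← genCombination_sub] at e
  obtain ⟨cp, cr, cs, ct, cu, w, h0, h2, h1, h3, h4⟩ := exists_lattice_of_dvd_genCombination e
  have key := le_norm_deepHole_sub (m := m) (by exact_mod_cast hm) cp cr cs ct cu w
  rw [← h0, ← h1, ← h2, ← h3, ← h4] at key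
  simp only [sub_sub_cancel] at key
  rw [← sum_natAbs_eq] at key
  exact_mod_cast key

theorem ediam_circulantGraphOf (m : ℕ) :
    (circulantGraphOf (Set.range fun i =>
      (circulantGen m i : ZMod (circulantOrder m)))).ediam = (5 * m + 3 : ℕ) := by
  refine le_antisymm (SimpleGraph.ediam_le_of_edist_le fun u v => ?_) ?_
  · obtain ⟨x, hx, hc⟩ : ∃ x : Fin 5 → ℤ, ∑ i, (x i).natAbs ≤ 5 * m + 3 ∧
        ∑ i, (x i : ZMod (circulantOrder m)) * circulantGen m i = v - u := by
      rcases Nat.eq_zero_or_pos m with rfl | hm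
      · exact exists_sum_eq_zero _
      · exact exists_sum_eq_of_one_le hm _
    have := edist_add_sum_le (fun i => (circulantGen m i : ZMod (circulantOrder m))) x
      Finset.univ u
    rw [hc, add_sub_cancel] at this
    exact this.trans (by exact_mod_cast hx)
  · obtain ⟨c, hc⟩ := exists_le_sum_natAbs m
    refine le_trans ?_ (SimpleGraph.edist_le_ediam (u := 0) (v := c))
    rw [SimpleGraph.edist]
    refine le_iInf fun w => ?_
    obtain ⟨x, hx, h⟩ := exists_sum_of_walk _ w
    rw [zero_add] at h
    exact_mod_cast (hc x h.symm).trans hx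

theorem theorem8 (k : ℕ) (hk : k ≡ 3 [MOD 5]) :
    ∃ (n : ℕ) (g : Fin 5 → ℤ),
      0 < n ∧
      (n : ℚ) = (512 * (k : ℚ) ^ 5 + 1280 * (k : ℚ) ^ 4 + 6560 * (k : ℚ) ^ 3
        + 7600 * (k : ℚ) ^ 2 + 4180 * (k : ℚ) + 1344) / 3125 ∧
      g 0 = 1 ∧
      (g 1 : ℚ) = (128 * (k : ℚ) ^ 4 + 64 * (k : ℚ) ^ 3 + 1112 * (k : ℚ) ^ 2
        - 1224 * (k : ℚ) - 1557) / 625 ∧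
      (g 2 : ℚ) = (256 * (k : ℚ) ^ 4 + 448 * (k : ℚ) ^ 3 + 2944 * (k : ℚ) ^ 2
        + 1592 * (k : ℚ) + 271) / 625 ∧
      (g 3 : ℚ) = (256 * (k : ℚ) ^ 4 + 608 * (k : ℚ) ^ 3 + 3104 * (k : ℚ) ^ 2
        + 3062 * (k : ℚ) + 726) / 625 ∧
      (g 4 : ℚ) = (384 * (k : ℚ) ^ 4 + 672 * (k : ℚ) ^ 3 + 4216 * (k : ℚ) ^ 2
        + 2338 * (k : ℚ) - 456) / 625 ∧
      ∃ S : Set (ZMod n), S = Set.range (fun i : Fin 5 => (g i : ZMod n)) ∧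
        S.encard = 5 ∧
        (∀ s ∈ S, -s ∉ S) ∧
        AddSubgroup.closure S = ⊤ ∧
        (∀ v : ZMod n, ((circulantGraphOf S).neighborSet v).encard = 10) ∧
        (circulantGraphOf S).ediam = (k : ℕ∞) := by
  obtain ⟨m, rfl⟩ : ∃ m, k = 5 * m + 3 := ⟨k / 5, by
    have : k % 5 = 3 := hk
    omega⟩
  have card : (Set.range fun i => (circulantGen m i : ZMod (circulantOrder m))).encard = 5 := by
    rw [← Set.image_univ, (intCast_circulantGen_injective m).encard_image, Set.encard_univ]
    simp
  have neg_notMem : ∀ s ∈ Set.range fun i => (circulantGen m i : ZMod (circulantOrder m)),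
      -s ∉ Set.range fun i => (circulantGen m i : ZMod (circulantOrder m)) := by
    rintro _ ⟨i, rfl⟩ ⟨j, hj⟩
    exact circulantGen_add_ne_zero m j i (by simp only at hj; rw [hj]; simp)
  refine ⟨circulantOrder m, circulantGen m, by unfold circulantOrder; positivity, ?_, rfl,
    ?_, ?_, ?_, ?_, _, rfl, card, neg_notMem, ?_, fun v => ?_, ediam_circulantGraphOf m⟩
  · simp only [circulantOrder]
    push_cast
    ring
  iterate 4
    · simp only [circulantGen, Matrix.cons_val]
      push_cast
      ring
  · rw [eq_top_iff]
    rintro z -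
    have h1 : (1 : ZMod (circulantOrder m)) ∈
        AddSubgroup.closure (Set.range fun i => (circulantGen m i : ZMod (circulantOrder m))) :=
      AddSubgroup.subset_closure ⟨0, by simp [circulantGen]⟩
    simpa using zsmul_mem h1 (z.cast : ℤ)
  · rw [encard_neighborSet_circulantGraphOf neg_notMem, card]
    norm_num
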